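/- All sets are finite and a distribution is a probability distribution on a finite set. **Independence.** For a distribution $P$ and variables $X,Y,Z$, "$X$ and $Y$ are independent given $Z$ in $P$" means $P(x,z)P(y,z)=P(x,y,z)P(z)$ for all values $x,y,z$. For a family $X=(X_w)_{w\in W}$ and $T\subseteq W$ put $X_T=(X_w)_{w\in T}$. **Factored space models.** A factored space is a product $\Omega=\prod_{i\in I}\Omega_i$ of finitely many finite sets. For $J\subseteq I$ let $\omega_J$ and $C_J$ denote the projections of $\omega\in\Omega$ and $C\subseteq\Omega$ to the coordinates in $J$. The set $J$ generates a variable $X$ given an event $C\subseteq\Omega$ if $C=C_J\times C_{I\setminus J}$ and $X(\omega)$ is a function of $\omega_J$ for $\omega\in C$. The history $\mathcal H(X\mid C)$ is the intersection of all $J$ that generate $X$ given $C$. Variables $X,Y$ are structurally independent given $Z$ if $\mathcal H(X\mid Z=z)\cap\mathcal H(Y\mid Z=z)=\varnothing$ for every value $z$ of $Z$. A pair $(\Omega,O)$ with $O\colon\Omega\to\mathrm{Obs}$ is a factored space model of a distribution $P$ on $\mathrm{Obs}$ if there is a distribution $Q$ on $\Omega$ with $Q(\omega)=\prod_i Q(\omega_i)$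 for all $\omega$ (where $Q(\omega_i)$ is the probability that the $i$-th coordinate equals $\omega_i$) and $Q(O=o)=P(o)$ for all $o\in\mathrm{Obs}$. It is a perfect map of $P$ with regard to a family of variables $X=(X_w)_{w\in W}$ on $\mathrm{Obs}$ (regarded as variables $X_w\circ O$ on $\Omega$) if it is a factored space model of $P$ and, for all $W_1,W_2,W_3\subseteq W$, $X_{W_1}$ and $X_{W_2}$ are independent given $X_{W_3}$ in $P$ if and only if $X_{W_1}\circ O$ and $X_{W_2}\circ O$ are structurally independent given $X_{W_3}\circ O$ in $\Omega$. **DAGs.** Let $V$ be a finite set of nodes, $\mathrm{Val}_v$ a finite set for each $v\in V$, and let $X_v$ be the $v$-th coordinate on $\mathrm{Val}=\prod_{v\in V}\mathrm{Val}_v$. In a DAG $G$ on $V$, sets $V_1,V_2\subseteq V$ are d-separated given $V_3\subseteq V$ (the three sets may overlap) if no trail from a node of $V_1$ to a node of $V_2$, trails of length zero included, is active given $V_3$; a trail is active if each collider on it is in $V_3$ or has a descendant in $V_3$ and no other node on it, end nodes included, is in $V_3$. The DAG $G$ is a perfect map of a distribution $P$ on $\mathrm{Val}$ if for all $V_1,V_2,V_3\subseteq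 V$, $V_1$ and $V_2$ are d-separated given $V_3$ if and only if $X_{V_1}$ and $X_{V_2}$ are independent given $X_{V_3}$ in $P$. The factored space model constructed from $G$ has the index set $I=\{(v,x_{\mathrm{pa}(v)}) : v\in V,\ x_{\mathrm{pa}(v)}\in\prod_{u\in\mathrm{pa}(v)}\mathrm{Val}_u\}$, the factors $\Omega_{(v,x_{\mathrm{pa}(v)})}=\mathrm{Val}_v$, and the observation $O=(\hat X_v)_{v\in V}$, where $\hat X_v(\omega)=\omega_{(v,\hat X_{\mathrm{pa}(v)}(\omega))}$ recursively. **Proposition (Perfect maps of graphs and factored spaces).** 1. Let $P$ be a distribution on $\mathrm{Val}=\prod_{v\in V}\mathrm{Val}_v$. If a DAG $G$ with nodes $V$ is a perfect map of $P$, then the factored space model constructed from $G$ is a perfect map of $P$ with regard to the node variables $(X_v)_{v\in V}$. 2. The converse fails. Let $P$ be any distribution on a product $\mathrm{Val}_1\times\mathrm{Val}_2$ for which there is a function $f$ with $X_2=f(X_1)$ $P$-almost surely. Then there is a factored space model that is a perfect map of $P$ with regard to $(X_1,X_2)$, but no DAG with nodes $\{1,2\}$ is a perfect map of $P$. Such distributions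 exist with $|\mathrm{Val}_1|,|\mathrm{Val}_2|\ge 2$, with $f$ surjective and not injective, and with $P(x_1,x_2)>0$ if and only if $x_2=f(x_1)$. -/

import Mathlib

noncomputable section

universe u v w uI uΩ uO

namespace FactoredSpaces

/-! ### Discrete random variables -/

/-- The probability of the event `A`. -/
def prob {S : Type u} (P : PMF S) (A : Set S) : ENNReal := P.toOuterMeasure A

/-- `X` and `Y` are independent given `Z` under `P`:
`P(x, z) P(y, z) = P(x, y, z) P(z)` for all values `x, y, z`. -/
def CondIndep {S : Type u} {A B C : Type*} (P : PMF S)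
    (X : S → A) (Y : S → B) (Z : S → C) : Prop :=
  ∀ x y z,
    prob P {s | X s = x ∧ Z s = z} * prob P {s | Y s = y ∧ Z s = z} =
      prob P {s | X s = x ∧ Y s = y ∧ Z s = z} * prob P {s | Z s = z}

/-- The joint variable `X_T = (X_t)_{t ∈ T}` of a family of variables `X`. -/
def joint {S : Type u} {W : Type v} {Val : W → Type w} (X : ∀ t, S → Val t) (T : Set W) :
    S → ∀ t : T, Val t :=
  fun s t => X t s

/-- `Y` is derived from `X` on the event `C` (is a deterministic function of `X` on `C`). -/
def DerivedOn {S : Type*} {A B : Type*} (C : Set S) (X : S → A) (Y : S → B) : Prop :=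
  ∃ f : A → B, ∀ s ∈ C, Y s = f (X s)

/-! ### Factored spaces: the sample space is `∀ i, Ω i` -/

section FactoredSpace

variable {I : Type uI} {Ω : I → Type uΩ}

/-- The background variable `U_J`, that is, the projection to the coordinates in `J`. -/
def background (J : Set I) : (∀ i, Ω i) → ∀ j : J, Ω j := fun ω j => ω j

/-- The product `C_J × C_{I \ J}` of the two projections of `C`, as a set of families over `I`. -/
def projProd (J : Set I) (C : Set (∀ i, Ω i)) : Set (∀ i, Ω i) :=
  {ω | background J ω ∈ background J '' C ∧ background Jᶜ ω ∈ background Jᶜ '' C}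

/-- `J` disintegrates `C`, that is, `C = C_J × C_{I \ J}`. -/
def Disintegrates (J : Set I) (C : Set (∀ i, Ω i)) : Prop := C = projProd J C

/-- `J` generates `X` given `C`. -/
def Generates {A : Type*} (J : Set I) (X : (∀ i, Ω i) → A) (C : Set (∀ i, Ω i)) : Prop :=
  DerivedOn C (background J) X ∧ Disintegrates J C

/-- The history of `X` given `C`: the intersection of all `J` that generate `X` given `C`. -/
def history {A : Type*} (X : (∀ i, Ω i) → A) (C : Set (∀ i, Ω i)) : Set I :=
  ⋂₀ {J | Generates J X C}

/-- `X` and `Y` are structurally independent given `Z`. -/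
def StructIndep {A B D : Type*} (X : (∀ i, Ω i) → A) (Y : (∀ i, Ω i) → B)
    (Z : (∀ i, Ω i) → D) : Prop :=
  ∀ z, history X {ω | Z ω = z} ∩ history Y {ω | Z ω = z} = ∅

/-- `P` factorizes over the factored space: `P(ω) = ∏ i, P(ω_i)`. -/
def Factorizes [Fintype I] (P : PMF (∀ i, Ω i)) : Prop :=
  ∀ ω, P ω = ∏ i, prob P {ω' | ω' i = ω i}

end FactoredSpace

set_option linter.checkUnivs false in
/-- A factored space `∏ i, Ω i` (finitely many finite factors) with an observation variable
`O` into the observation space `Obs`. -/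
structure FSM (Obs : Type uO) where
  /-- The index set of the factors. -/
  I : Type uI
  /-- The index set is finite. -/
  fintypeI : Fintype I
  /-- The factors. -/
  Ω : I → Type uΩ
  /-- The factors are finite. -/
  finiteΩ : ∀ i, Finite (Ω i)
  /-- The observation variable. -/
  O : (∀ i, Ω i) → Obs

namespace FSM

variable {Obs : Type uO} (F : FSM.{uI, uΩ, uO} Obs)

/-- `F` is a factored space model for `P`: some distribution that factorizes over the factored
space has image `P` under the observation variable. -/
def IsModelOf (P : PMF Obs) : Prop :=
  ∃ Q : PMF (∀ i, F.Ω i),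
    (letI := F.fintypeI; Factorizes Q) ∧ ∀ o, prob Q {ω | F.O ω = o} = P o

/-- `F` is a perfect map of `P` with regard to the family of observed variables `X`.
An observed variable is given as a function `X t` of the observation; on the sample space of
`F` it is the variable `X t ∘ O`. -/
def IsPerfectMap {W : Type v} {Val : W → Type w} (P : PMF Obs) (X : ∀ t, Obs → Val t) : Prop :=
  F.IsModelOf P ∧
    ∀ W₁ W₂ W₃ : Set W,
      CondIndep P (joint X W₁) (joint X W₂) (joint X W₃) ↔
        StructIndep (joint (fun t => X t ∘ F.O) W₁) (joint (fun t => X t ∘ F.O) W₂)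
          (joint (fun t => X t ∘ F.O) W₃)

end FSM

/-! ### Directed acyclic graphs -/

/-- A directed acyclic graph with node set `V`. -/
structure DAG (V : Type u) extends Digraph V where
  /-- There is no directed cycle (in particular, no loop). -/
  acyclic : ∀ a, ¬ Relation.TransGen Adj a a

namespace DAG

variable {V : Type u} (G : DAG V)

/-- The parents of a node. -/
def parents (a : V) : Set V := {b | G.Adj b a}

/-- `w 0, …, w n` is a trail: consecutive nodes are joined by an edge, of either direction.
A single node is a trail (`n = 0`). -/
def IsTrail (n : ℕ) (w : ℕ → V) : Prop :=
  ∀ i < n, G.Adj (w i) (w (i + 1)) ∨ G.Adj (w (i + 1)) (w i)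

/-- The inner node `w i` of the trail `w 0, …, w n` is a collider `w (i-1) → w i ← w (i+1)`. -/
def IsCollider (n : ℕ) (w : ℕ → V) (i : ℕ) : Prop :=
  0 < i ∧ i < n ∧ G.Adj (w (i - 1)) (w i) ∧ G.Adj (w (i + 1)) (w i)

/-- The trail `w 0, …, w n` is active given `Z`: each collider on it is in `Z` or has a
descendant in `Z`, and no other node on it (end nodes included) is in `Z`. -/
def IsActive (Z : Set V) (n : ℕ) (w : ℕ → V) : Prop :=
  ∀ i ≤ n,
    (G.IsCollider n w i → ∃ d ∈ Z, Relation.ReflTransGen G.Adj (w i) d) ∧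
    (¬ G.IsCollider n w i → w i ∉ Z)

/-- `A` and `B` are d-separated given `Z`: no trail from `A` to `B` is active given `Z`.
The three sets may overlap. -/
def DSep (A B Z : Set V) : Prop :=
  ∀ (n : ℕ) (w : ℕ → V), G.IsTrail n w → w 0 ∈ A → w n ∈ B → ¬ G.IsActive Z n w

/-- `G` is a perfect map of the distribution `P` on the space of joint values of the nodes. -/
def IsPerfectMap {Val : V → Type v} (P : PMF (∀ a, Val a)) : Prop :=
  ∀ V₁ V₂ V₃ : Set V,
    G.DSep V₁ V₂ V₃ ↔
      CondIndep P (joint (fun a x => x a) V₁) (joint (fun a x => x a) V₂)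
        (joint (fun a x => x a) V₃)

theorem wellFounded_adj [Finite V] : WellFounded G.Adj := by
  have : Std.Irrefl (Relation.TransGen G.Adj) := ⟨G.acyclic⟩
  have h : WellFounded (Relation.TransGen G.Adj) := Finite.wellFounded_of_trans_of_irrefl _
  exact Subrelation.wf (fun {_ _} hab => Relation.TransGen.single hab) h

section Construction

variable (Val : V → Type v)

/-- The index set of the factored space built from `G`: pairs of a node and a joint value of
its parents. -/
abbrev Index : Type (max u v) := Σ a : V, ∀ b : G.parents a, Val b

variable [Finite V]

/-- The node variables on the factored space built from `G`, by recursion along the edges: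
`X_a(ω) = ω_(a, X_pa(a)(ω))`, see `nodeVar_eq`. -/
def nodeVar (a : V) (ω : ∀ i : G.Index Val, Val i.1) : Val a :=
  G.wellFounded_adj.fix (C := Val) (fun a X => ω ⟨a, fun b => X b.1 b.2⟩) a

theorem nodeVar_eq (a : V) (ω : ∀ i : G.Index Val, Val i.1) :
    G.nodeVar Val a ω = ω ⟨a, fun b => G.nodeVar Val b.1 ω⟩ :=
  G.wellFounded_adj.fix_eq (C := Val) (fun a X => ω ⟨a, fun b => X b.1 b.2⟩) a

/-- The factored space model constructed from `G`: the factor with index `(a, x_pa(a))` is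
`Val a`, and the observation is the family of all node variables. -/
def toFSM [∀ a, Finite (Val a)] : FSM.{max u v, v, max u v} (∀ a, Val a) where
  I := G.Index Val
  fintypeI := Fintype.ofFinite _
  Ω := fun i => Val i.1
  finiteΩ := fun _ => inferInstance
  O := fun ω a => G.nodeVar Val a ω

end Construction

end DAG

end FactoredSpaces

end

universe u v w

/-!
A DAG that is a perfect map of `P` is turned into a factored space by giving each node `a` one
independent factor for every joint value of its parents, which decides the value of `a` when the
parents have that value. Three facts make this a perfect map.

* *The model property* (`DAG.isModelOf_toFSM`). Every node is d-separated from each ancestrally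
  closed set not containing it given its parents (`DAG.dSep_parents`). The corresponding
  independences in `P` give the factorization `P(x) = ∏ P(x_a | x_pa(a))` (`DAG.prob_eq_prod`). With
  the conditional distributions on the factors, the right-hand side is the probability that the
  observation is `x`.
* *Structural independence implies independence* (`StructIndep.condIndep`), in every factored space
  model. An event disintegrates along `J` if and only if it is closed under splicing two of its
  outcomes along `J`; hence the generating sets are closed under intersection, and the history
  itself generates. Exchanging the coordinates outside the history of `X` between two outcomes
  preserves product weights and takes `{X = x, Z = z} × {Y = y, Z = z}` to
  `{X = x, Y = y, Z = z} × {Z = z}`.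
* *d-separation implies structural independence* (`DAG.DSep.structIndep`). Let `J` consist of the
  factors of the nodes reachable from `A` by active trails given `Z`, and of the factors of the
  nodes in `Z` that have a reachable parent. By induction along the edges, splicing two outcomes with the
  same values on `Z` along `J` retains these values, and gives the other nodes that matter the value
  in the first outcome if they are reachable, and in the second one if not
  (`DAG.nodeVar_piecewise`). So `J` generates `X_A`, and its complement generates `X_B`.

The perfect map property of the DAG closes the circle: independence in `P` gives d-separation, hence
structural independence, hence independence in `P`.

If `X₁` is almost surely a function of `X₀`, then `X₁` is independent of itself given `X₀`, but the
node `1` is not d-separated from itself given `{0}`, so no DAG is a perfect map. The factored space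
whose only factor is the support of `P` is one (`supportFSM_isPerfectMap`), as any two joint
variables `X`, `Y` are comparable: if `X` determines `Y`, then independence given `Z` forces `Y` to
be constant on each event `Z = z`, where its history is therefore empty.
-/

namespace FactoredSpaces

open scoped Classical

/-! ### Histories -/

section FactoredSpace

universe uI uΩ
variable {I : Type uI} {Ω : I → Type uΩ} {A B : Type*}

/-- An event disintegrates along `J` if and only if it is closed under splicing two of its outcomes
along `J`. -/
theorem disintegrates_iff {J : Set I} {C : Set (∀ i, Ω i)} :
    Disintegrates J C ↔ ∀ ω ∈ C, ∀ ω' ∈ C, J.piecewise ω ω' ∈ C := by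
  constructor
  · intro h ω hω ω' hω'
    rw [h]
    refine ⟨⟨ω, hω, ?_⟩, ⟨ω', hω', ?_⟩⟩
    · funext j
      exact (Set.piecewise_eq_of_mem J ω ω' j.2).symm
    · funext j
      exact (Set.piecewise_eq_of_notMem J ω ω' j.2).symm
  · intro h
    refine Set.Subset.antisymm (fun ω hω => ⟨⟨ω, hω, rfl⟩, ⟨ω, hω, rfl⟩⟩) ?_
    rintro ω ⟨⟨ω₁, h₁, e₁⟩, ⟨ω₂, h₂, e₂⟩⟩
    convert h ω₁ h₁ ω₂ h₂ using 1
    funext i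
    by_cases hi : i ∈ J
    · rw [Set.piecewise_eq_of_mem _ _ _ hi]
      exact (congrFun e₁ ⟨i, hi⟩).symm
    · rw [Set.piecewise_eq_of_notMem _ _ _ hi]
      exact (congrFun e₂ ⟨i, hi⟩).symm

theorem derivedOn_iff {S : Type*} [Nonempty B] {C : Set S} {X : S → A} {Y : S → B} :
    DerivedOn C X Y ↔ ∀ s ∈ C, ∀ t ∈ C, X s = X t → Y s = Y t := by
  constructor
  · rintro ⟨f, hf⟩ s hs t ht h
    rw [hf s hs, hf t ht, h]
  · intro h
    refine ⟨fun a => if ha : ∃ s ∈ C, X s = a then Y ha.choose else Classical.arbitrary B,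
      fun s hs => ?_⟩
    have ha : ∃ t ∈ C, X t = X s := ⟨s, hs, rfl⟩
    refine Eq.trans ?_ (dif_pos ha).symm
    exact h s hs _ ha.choose_spec.1 ha.choose_spec.2.symm

theorem generates_iff [Nonempty A] {J : Set I} {X : (∀ i, Ω i) → A} {C : Set (∀ i, Ω i)} :
    Generates J X C ↔
      (∀ ω ∈ C, ∀ ω' ∈ C, (∀ j ∈ J, ω j = ω' j) → X ω = X ω') ∧
        ∀ ω ∈ C, ∀ ω' ∈ C, J.piecewise ω ω' ∈ C := by
  rw [Generates, derivedOn_iff, disintegrates_iff]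
  simp only [background, funext_iff, Subtype.forall]

theorem generates_univ [Nonempty A] (X : (∀ i, Ω i) → A) (C : Set (∀ i, Ω i)) :
    Generates Set.univ X C := by
  refine generates_iff.2 ⟨fun ω _ ω' _ h => congrArg X (funext fun i => h i trivial), ?_⟩
  intro ω hω ω' _
  simpa using hω

theorem Generates.inter [Nonempty A] {J K : Set I} {X : (∀ i, Ω i) → A} {C : Set (∀ i, Ω i)}
    (hJ : Generates J X C) (hK : Generates K X C) : Generates (J ∩ K) X C := by
  rw [generates_iff] at *
  obtain ⟨hJX, hJC⟩ := hJ
  obtain ⟨hKX, hKC⟩ := hK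
  constructor
  · -- compare both outcomes with the one that agrees with `ω` on `J` and with `ω'` on `K`
    intro ω hω ω' hω' h
    have hmem := hJC ω hω ω' hω'
    rw [hJX ω hω _ hmem fun j hj => (Set.piecewise_eq_of_mem _ _ _ hj).symm]
    refine hKX _ hmem ω' hω' fun j hj => ?_
    by_cases hjJ : j ∈ J
    · rw [Set.piecewise_eq_of_mem _ _ _ hjJ, h j ⟨hjJ, hj⟩]
    · exact Set.piecewise_eq_of_notMem _ _ _ hjJ
  · intro ω hω ω' hω'
    convert hJC _ (hKC ω hω ω' hω') ω' hω' using 1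
    funext i
    by_cases hi : i ∈ J <;> by_cases hi' : i ∈ K <;> simp [Set.piecewise, hi, hi']

/-- As generating sets are closed under finite intersections, the history is the least set that
generates `X` given `C`. -/
theorem generates_history [Finite I] [Nonempty A] (X : (∀ i, Ω i) → A) (C : Set (∀ i, Ω i)) :
    Generates (history X C) X C := by
  have h : ∀ s : Set (Set I), s.Finite → s ⊆ {J | Generates J X C} → Generates (⋂₀ s) X C := by
    intro s hs
    induction s, hs using Set.Finite.induction_on with
    | empty => intro _; rw [Set.sInter_empty]; exact generates_univ X C
    | insert _ _ ih =>
      intro hsub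
      rw [Set.sInter_insert]
      exact (hsub (Set.mem_insert _ _)).inter (ih ((Set.subset_insert _ _).trans hsub))
  exact h _ (Set.toFinite _) subset_rfl

theorem Generates.history_subset {J : Set I} {X : (∀ i, Ω i) → A} {C : Set (∀ i, Ω i)}
    (h : Generates J X C) : history X C ⊆ J :=
  Set.sInter_subset_of_mem h

end FactoredSpace

/-! ### Structural independence implies independence -/

theorem prob_mul_prob {S : Type*} (Q : PMF S) (A B : Set S) :
    prob Q A * prob Q B =
      ∑' p : S × S, if p.1 ∈ A ∧ p.2 ∈ B then Q p.1 * Q p.2 else 0 := by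
  rw [prob, prob, PMF.toOuterMeasure_apply, PMF.toOuterMeasure_apply, ENNReal.tsum_prod',
    ← ENNReal.tsum_mul_right]
  refine tsum_congr fun a => ?_
  rw [← ENNReal.tsum_mul_left]
  refine tsum_congr fun b => ?_
  by_cases ha : a ∈ A <;> by_cases hb : b ∈ B <;> simp [ha, hb]

theorem prob_map {S T : Type*} (Q : PMF S) (O : S → T) (E : Set T) :
    prob (Q.map O) E = prob Q (O ⁻¹' E) :=
  PMF.toOuterMeasure_map_apply O Q E

section Soundness

universe uI uΩ
variable {I : Type uI} {Ω : I → Type uΩ} {A B D : Type*}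

/-- The involution of pairs of outcomes that exchanges the coordinates outside `J`. -/
noncomputable def exchange (J : Set I) : (∀ i, Ω i) × (∀ i, Ω i) ≃ (∀ i, Ω i) × (∀ i, Ω i) where
  toFun p := (J.piecewise p.1 p.2, J.piecewise p.2 p.1)
  invFun p := (J.piecewise p.1 p.2, J.piecewise p.2 p.1)
  left_inv p := by
    ext i <;> by_cases hi : i ∈ J <;> simp [Set.piecewise, hi]
  right_inv p := by
    ext i <;> by_cases hi : i ∈ J <;> simp [Set.piecewise, hi]

/-- A product distribution assigns equal weight to a pair of outcomes and to the pair obtained by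
exchanging coordinates. -/
theorem Factorizes.mul_piecewise [Fintype I] {Q : PMF (∀ i, Ω i)} (hQ : Factorizes Q) (J : Set I)
    (ω ω' : ∀ i, Ω i) : Q (J.piecewise ω ω') * Q (J.piecewise ω' ω) = Q ω * Q ω' := by
  rw [hQ, hQ (J.piecewise ω' ω), hQ ω, hQ ω', ← Finset.prod_mul_distrib,
    ← Finset.prod_mul_distrib]
  refine Finset.prod_congr rfl fun i _ => ?_
  by_cases hi : i ∈ J
  · rw [Set.piecewise_eq_of_mem _ _ _ hi, Set.piecewise_eq_of_mem _ _ _ hi]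
  · rw [Set.piecewise_eq_of_notMem _ _ _ hi, Set.piecewise_eq_of_notMem _ _ _ hi, mul_comm]

/-- Structural independence is sound for every product distribution. On `{Z = z}`, exchanging the
coordinates outside the history of `X` matches the pairs in `{X = x} × {Y = y}` with the pairs
in `{X = x, Y = y} × {Z = z}`. -/
theorem StructIndep.condIndep [Fintype I] {Q : PMF (∀ i, Ω i)} (hQ : Factorizes Q)
    {X : (∀ i, Ω i) → A} {Y : (∀ i, Ω i) → B} {Z : (∀ i, Ω i) → D} (h : StructIndep X Y Z) :
    CondIndep Q X Y Z := by
  intro x y z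
  obtain ⟨ω₀, -⟩ := Q.support_nonempty
  have : Nonempty A := ⟨X ω₀⟩
  have : Nonempty B := ⟨Y ω₀⟩
  set C : Set (∀ i, Ω i) := {ω | Z ω = z}
  set J := history X C
  obtain ⟨hX, hC⟩ := generates_iff.1 (generates_history X C)
  obtain ⟨hY, -⟩ := generates_iff.1 (generates_history Y C)
  have hdisj : ∀ i ∈ history Y C, i ∉ J := fun i hi hi' => by
    have : i ∈ history X C ∩ history Y C := ⟨hi', hi⟩
    rw [h z] at this
    exact this
  have key : ∀ ω ∈ C, ∀ ω' ∈ C, J.piecewise ω ω' ∈ C ∧ X (J.piecewise ω ω') = X ω ∧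
      Y (J.piecewise ω ω') = Y ω' := fun ω hω ω' hω' =>
    have hm := hC ω hω ω' hω'
    ⟨hm, hX _ hm ω hω fun j hj => Set.piecewise_eq_of_mem _ _ _ hj,
      hY _ hm ω' hω' fun j hj => Set.piecewise_eq_of_notMem _ _ _ (hdisj j hj)⟩
  have hinv : ∀ ω ω' : ∀ i, Ω i,
      J.piecewise (J.piecewise ω ω') (J.piecewise ω' ω) = ω := fun ω ω' =>
    congrArg Prod.fst ((exchange J).left_inv (ω, ω'))
  rw [prob_mul_prob, prob_mul_prob, ← (exchange J).tsum_eq]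
  refine tsum_congr fun p => ?_
  obtain ⟨ω, ω'⟩ := p
  simp only [exchange, Equiv.coe_fn_mk, hQ.mul_piecewise, Set.mem_ofPred_eq]
  refine if_congr ⟨?_, ?_⟩ rfl rfl
  · rintro ⟨⟨h1, h2⟩, h3, h4⟩
    have k1 := key _ h2 _ h4
    have k2 := key _ h4 _ h2
    rw [hinv] at k1 k2
    exact ⟨⟨k1.2.1.trans h1, k1.2.2.trans h3, k1.1⟩, k2.1⟩
  · rintro ⟨⟨h1, h2, h3⟩, h4⟩
    have k1 := key _ h3 _ h4
    have k2 := key _ h4 _ h3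
    exact ⟨⟨k1.2.1.trans h1, k1.1⟩, k2.2.2.trans h2, k2.1⟩

end Soundness

theorem FSM.IsModelOf.condIndep {Obs A B D : Type*} {F : FSM Obs} {P : PMF Obs}
    (hF : F.IsModelOf P) {X : Obs → A} {Y : Obs → B} {Z : Obs → D}
    (h : StructIndep (X ∘ F.O) (Y ∘ F.O) (Z ∘ F.O)) : CondIndep P X Y Z := by
  obtain ⟨Q, hQ, hP⟩ := hF
  have hPQ : P = Q.map F.O := by
    ext o
    rw [← hP o, ← PMF.toOuterMeasure_apply_singleton (Q.map F.O) o,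
      PMF.toOuterMeasure_map_apply]
    rfl
  let := F.fintypeI
  intro x y z
  simp only [hPQ, prob_map]
  exact h.condIndep hQ x y z

namespace DAG

variable {V : Type u} (G : DAG V)

/-! ### Active trails -/

/-- The nodes at the end of an active trail from `A`. -/
def reach (A Z : Set V) : Set V :=
  {b | ∃ (n : ℕ) (w : ℕ → V), G.IsTrail n w ∧ w 0 ∈ A ∧ w n = b ∧ G.IsActive Z n w}

variable {G} {A B Z : Set V}

theorem dSep_iff : G.DSep A B Z ↔ ∀ b ∈ G.reach A Z, b ∉ B := by
  constructor
  · rintro h b ⟨n, w, ht, h0, rfl, hact⟩ hb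
    exact h n w ht h0 hb hact
  · intro h n w ht h0 hn hact
    exact h _ ⟨n, w, ht, h0, rfl, hact⟩ hn

theorem notMem_of_mem_reach {b : V} (hb : b ∈ G.reach A Z) : b ∉ Z := by
  obtain ⟨n, w, -, -, rfl, hact⟩ := hb
  exact (hact n le_rfl).2 fun h => lt_irrefl _ h.2.1

theorem mem_reach_self {a : V} (ha : a ∈ A) (haZ : a ∉ Z) : a ∈ G.reach A Z :=
  ⟨0, fun _ => a, fun i hi => absurd hi (Nat.not_lt_zero i), ha, rfl, fun _ _ =>
    ⟨fun h => absurd h.2.1 (by lia), fun _ => haZ⟩⟩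

/-- An active trail to `b` extends along an edge between `b` and `c ∉ Z` in either direction if
`b` does not become an inactive collider. -/
theorem mem_reach_of_adj {b c : V} (hb : b ∈ G.reach A Z) (hc : c ∉ Z)
    (h : G.Adj b c ∨ G.Adj c b ∧ ∃ d ∈ Z, Relation.ReflTransGen G.Adj b d) :
    c ∈ G.reach A Z := by
  obtain ⟨n, w, ht, h0, hn, hact⟩ := id hb
  have hbZ := notMem_of_mem_reach hb
  set w' : ℕ → V := fun i => if i ≤ n then w i else c with hw'
  have hw : ∀ i ≤ n, w' i = w i := fun i hi => if_pos hi
  have hw1 : w' (n + 1) = c := by simp [hw']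
  refine ⟨n + 1, w', ?_, by rwa [hw 0 (Nat.zero_le _)], hw1, ?_⟩
  · intro i hi
    rcases Nat.lt_succ_iff_lt_or_eq.1 hi with hi | rfl
    · simpa only [hw i hi.le, hw (i + 1) hi] using ht i hi
    · rw [hw i le_rfl, hw1, hn]
      exact h.imp_right And.left
  · intro i hi
    have hi' : i < n ∨ i = n ∨ i = n + 1 := by lia
    rcases hi' with hi | rfl | rfl
    · -- the status of the inner nodes of the given trail does not change
      have hcol : G.IsCollider (n + 1) w' i ↔ G.IsCollider n w i := by
        simp only [IsCollider, hw i hi.le, hw (i + 1) hi, hw (i - 1) (by lia), hi,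
          Nat.lt_succ_of_lt hi]
      simpa only [hcol, hw i hi.le] using hact i hi.le
    · rw [hw i le_rfl, hn]
      refine ⟨fun hcol => ?_, fun _ => hbZ⟩
      have hcb := hcol.2.2.2
      rw [hw1, hw i le_rfl, hn] at hcb
      rcases h with h | h
      · exact absurd ((Relation.TransGen.single h).tail hcb) (G.acyclic b)
      · exact h.2
    · refine ⟨fun hcol => absurd hcol.2.1 (lt_irrefl _), fun _ => ?_⟩
      rwa [hw1]

/-- An active trail that meets a collider `b ∈ Z` from the parent `p` continues to any other
parent outside `Z`. -/
theorem mem_reach_of_collider {p b q : V} (hp : p ∈ G.reach A Z) (hpb : G.Adj p b) (hb : b ∈ Z)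
    (hqb : G.Adj q b) (hq : q ∉ Z) : q ∈ G.reach A Z := by
  obtain ⟨n, w, ht, h0, hn, hact⟩ := id hp
  have hpZ := notMem_of_mem_reach hp
  set w' : ℕ → V := fun i => if i ≤ n then w i else if i = n + 1 then b else q with hw'
  have hw : ∀ i ≤ n, w' i = w i := fun i hi => if_pos hi
  have hw1 : w' (n + 1) = b := by simp [hw']
  have hw2 : w' (n + 2) = q := by simp [hw']
  refine ⟨n + 2, w', ?_, by rwa [hw 0 (Nat.zero_le _)], hw2, ?_⟩
  · intro i hi
    rcases Nat.lt_succ_iff_lt_or_eq.1 hi with hi | rfl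
    · rcases Nat.lt_succ_iff_lt_or_eq.1 hi with hi | rfl
      · simpa only [hw i hi.le, hw (i + 1) hi] using ht i hi
      · rw [hw i le_rfl, hw1, hn]
        exact Or.inl hpb
    · rw [hw1, hw2]
      exact Or.inr hqb
  · intro i hi
    have hi' : i < n ∨ i = n ∨ i = n + 1 ∨ i = n + 2 := by lia
    rcases hi' with hi | rfl | rfl | rfl
    · have hcol : G.IsCollider (n + 2) w' i ↔ G.IsCollider n w i := by
        simp only [IsCollider, hw i hi.le, hw (i + 1) hi, hw (i - 1) (by lia), hi,
          show i < n + 2 by lia]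
      simpa only [hcol, hw i hi.le] using hact i hi.le
    · rw [hw i le_rfl, hn]
      refine ⟨fun hcol => ?_, fun _ => hpZ⟩
      have hbp := hcol.2.2.2
      rw [hw1, hw i le_rfl, hn] at hbp
      exact absurd ((Relation.TransGen.single hpb).tail hbp) (G.acyclic p)
    · rw [hw1]
      refine ⟨fun _ => ⟨b, hb, .refl⟩, fun hcol => absurd ?_ hcol⟩
      refine ⟨by lia, by lia, ?_, ?_⟩
      · rw [Nat.add_sub_cancel, hw n le_rfl, hw1, hn]
        exact hpb
      · rw [hw1, hw2]
        exact hqb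
    · refine ⟨fun hcol => absurd hcol.2.1 (lt_irrefl _), fun _ => ?_⟩
      rwa [hw2]

/-- Reachability spreads to descendants if none of the nodes passed has a descendant in `Z`. -/
theorem mem_reach_of_descendant {b d : V} (hb : b ∈ G.reach A Z)
    (hbd : Relation.ReflTransGen G.Adj b d)
    (hZ : ¬ ∃ z ∈ Z, Relation.ReflTransGen G.Adj b z) : d ∈ G.reach A Z := by
  induction hbd with
  | refl => exact hb
  | tail hbc hcd ih =>
    exact mem_reach_of_adj ih (fun hd => hZ ⟨_, hd, hbc.tail hcd⟩) (Or.inl hcd)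

/-- Reachability from `A` includes every `p ∉ Z` that is a parent of an ancestor of `A` without
descendants in `Z`: a directed path that is traversed backwards has no colliders. -/
theorem mem_reach_of_ancestor {p b a : V} (hpb : G.Adj p b) (hp : p ∉ Z) (ha : a ∈ A)
    (hba : Relation.ReflTransGen G.Adj b a)
    (hZ : ¬ ∃ z ∈ Z, Relation.ReflTransGen G.Adj b z) : p ∈ G.reach A Z := by
  have hpath : ∃ (n : ℕ) (w : ℕ → V), w 0 = a ∧ w n = p ∧
      (∀ i < n, G.Adj (w (i + 1)) (w i)) ∧ ∀ i ≤ n, w i ∉ Z := by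
    clear ha
    induction hba with
    | refl =>
      refine ⟨1, fun i => Nat.casesOn i b fun _ => p, rfl, rfl, ?_, ?_⟩
      · rintro (_ | i) hi
        · exact hpb
        · exact absurd hi (by lia)
      · rintro (_ | i) -
        · exact fun hb => hZ ⟨b, hb, .refl⟩
        · exact hp
    | @tail c d hbc hcd ih =>
      obtain ⟨n, w, h0, hn, hw, hr⟩ := ih
      refine ⟨n + 1, fun i => Nat.casesOn i d w, rfl, hn, ?_, ?_⟩
      · rintro (_ | i) hi
        · subst h0
          exact hcd
        · exact hw i (Nat.lt_of_succ_lt_succ hi)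
      · rintro (_ | i) hi
        · exact fun hd => hZ ⟨d, hd, hbc.tail hcd⟩
        · exact hr i (Nat.le_of_succ_le_succ hi)
  obtain ⟨n, w, h0, hn, hw, hr⟩ := hpath
  refine ⟨n, w, fun i hi => Or.inr (hw i hi), h0 ▸ ha, hn, fun i hi => ⟨?_, ?_⟩⟩
  · rintro ⟨hpos, -, hin, -⟩
    have hout := hw (i - 1) (by lia)
    rw [Nat.sub_add_cancel hpos] at hout
    exact absurd ((Relation.TransGen.single hin).tail hout) (G.acyclic _)
  · exact fun _ => hr i hi

/-- Outside `Z`, a node `b` with a descendant in `A ∪ B ∪ Z` and its parent `p` are either both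
reachable or both unreachable. -/
theorem mem_reach_iff_of_adj (h : G.DSep A B Z) {p b : V} (hpb : G.Adj p b) (hp : p ∉ Z)
    (hb : b ∉ Z) (hd : ∃ d ∈ A ∪ B ∪ Z, Relation.ReflTransGen G.Adj b d) :
    p ∈ G.reach A Z ↔ b ∈ G.reach A Z := by
  refine ⟨fun hr => mem_reach_of_adj hr hb (Or.inl hpb), fun hr => ?_⟩
  by_cases hZ : ∃ z ∈ Z, Relation.ReflTransGen G.Adj b z
  · exact mem_reach_of_adj hr hp (Or.inr ⟨hpb, hZ⟩)
  · obtain ⟨d, (hdA | hdB) | hdZ, hbd⟩ := hd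
    · exact mem_reach_of_ancestor hpb hp hdA hbd hZ
    · exact absurd hdB (dSep_iff.1 h d (mem_reach_of_descendant hr hbd hZ))
    · exact absurd ⟨d, hdZ, hbd⟩ hZ

/-! ### d-separation implies structural independence -/

section

variable [Finite V] {Val : V → Type v}

/-- The node variable of `a` agrees in two outcomes if the variables of the parents and the
factor that is read off agree. -/
theorem nodeVar_congr {a : V} {ω ω' : ∀ i : G.Index Val, Val i.1}
    (hpa : ∀ p, G.Adj p a → G.nodeVar Val p ω = G.nodeVar Val p ω')
    (ha : ∀ x : ∀ b : G.parents a, Val b, ω ⟨a, x⟩ = ω' ⟨a, x⟩) :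
    G.nodeVar Val a ω = G.nodeVar Val a ω' := by
  rw [nodeVar_eq, nodeVar_eq, ha]
  congr 2
  funext b
  exact hpa b.1 b.2

/-- The nodes on the side of `A`: the nodes reachable from `A`, and the nodes in `Z` with a
reachable parent. A node in `Z` is never reachable itself, but its factors have to be on the same
side as its parents outside `Z`, which are all reachable if one of them is. -/
def sideNodes (G : DAG V) (A Z : Set V) : Set V :=
  G.reach A Z ∪ {b | b ∈ Z ∧ ∃ p ∈ G.reach A Z, G.Adj p b}

/-- Splicing two outcomes that agree on `Z` along `sideNodes`: the relevant node variables keep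
their value on `Z`, are those of the first outcome at nodes reachable from `A`, and are those of the
second outcome elsewhere. -/
theorem nodeVar_piecewise (h : G.DSep A B Z) {ω ω' : ∀ i : G.Index Val, Val i.1}
    (hZ : ∀ b ∈ Z, G.nodeVar Val b ω = G.nodeVar Val b ω') (b : V)
    (hd : ∃ d ∈ A ∪ B ∪ Z, Relation.ReflTransGen G.Adj b d) :
    (b ∈ G.reach A Z ∪ Z →
      G.nodeVar Val b ({i : G.Index Val | i.1 ∈ G.sideNodes A Z}.piecewise ω ω') =
        G.nodeVar Val b ω) ∧
    (b ∉ G.reach A Z →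
      G.nodeVar Val b ({i : G.Index Val | i.1 ∈ G.sideNodes A Z}.piecewise ω ω') =
        G.nodeVar Val b ω') := by
  induction b using G.wellFounded_adj.induction with
  | _ b ih =>
  have hdp : ∀ p, G.Adj p b → ∃ d ∈ A ∪ B ∪ Z, Relation.ReflTransGen G.Adj p d := by
    obtain ⟨d, hd, hbd⟩ := hd
    exact fun p hp => ⟨d, hd, hbd.head hp⟩
  by_cases hS : b ∈ G.sideNodes A Z
  · -- all parents are reachable or in `Z`, so `b` has the same value as in the first outcome
    have hpar : ∀ p, G.Adj p b → p ∈ G.reach A Z ∪ Z := by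
      intro p hpb
      by_cases hpZ : p ∈ Z
      · exact Or.inr hpZ
      left
      rcases hS with hS | ⟨hbZ, q, hq, hqb⟩
      · exact (mem_reach_iff_of_adj h hpb hpZ (notMem_of_mem_reach hS) hd).2 hS
      · exact mem_reach_of_collider hq hqb hbZ hpb hpZ
    have heq := nodeVar_congr (fun p hp => (ih p hp (hdp p hp)).1 (hpar p hp)) fun x =>
      Set.piecewise_eq_of_mem {i : G.Index Val | i.1 ∈ G.sideNodes A Z} ω ω' (i := ⟨b, x⟩) hS
    refine ⟨fun _ => heq, fun hr => heq.trans (hZ b ?_)⟩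
    exact (hS.resolve_left hr).1
  · -- no parent is reachable, so `b` has the same value as in the second outcome
    have hpar : ∀ p, G.Adj p b → p ∉ G.reach A Z := by
      intro p hpb hp
      by_cases hbZ : b ∈ Z
      · exact hS (Or.inr ⟨hbZ, p, hp, hpb⟩)
      · exact hS (Or.inl (mem_reach_of_adj hp hbZ (Or.inl hpb)))
    have heq := nodeVar_congr (fun p hp => (ih p hp (hdp p hp)).2 (hpar p hp)) fun x =>
      Set.piecewise_eq_of_notMem {i : G.Index Val | i.1 ∈ G.sideNodes A Z} ω ω' (i := ⟨b, x⟩) hS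
    refine ⟨fun hb => heq.trans (hZ b ?_).symm, fun _ => heq⟩
    exact hb.resolve_left fun hr => hS (Or.inl hr)

/-- In the factored space constructed from a DAG, d-separation implies structural independence: the
factors of `sideNodes` generate `X_A`, and the other factors generate `X_B`. -/
theorem DSep.structIndep [∀ a, Nonempty (Val a)] (h : G.DSep A B Z) :
    StructIndep (joint (fun a => G.nodeVar Val a) A) (joint (fun a => G.nodeVar Val a) B)
      (joint (fun a => G.nodeVar Val a) Z) := by
  intro z
  set C := {ω : ∀ i : G.Index Val, Val i.1 | joint (fun a => G.nodeVar Val a) Z ω = z}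
  set J : Set (G.Index Val) := {i | i.1 ∈ G.sideNodes A Z}
  have hZ : ∀ ω ∈ C, ∀ ω' ∈ C, ∀ b ∈ Z, G.nodeVar Val b ω = G.nodeVar Val b ω' :=
    fun ω hω ω' hω' b hb => congrFun (Eq.trans hω (Eq.symm hω')) ⟨b, hb⟩
  have hC : ∀ ω ∈ C, ∀ ω' ∈ C, J.piecewise ω ω' ∈ C := by
    intro ω hω ω' hω'
    refine Eq.trans (funext fun b => ?_) hω
    exact (nodeVar_piecewise h (hZ ω hω ω' hω') b ⟨b, Or.inr b.2, .refl⟩).1 (Or.inr b.2)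
  have hA : Generates J (joint (fun a => G.nodeVar Val a) A) C := by
    refine generates_iff.2 ⟨fun ω hω ω' hω' hJ => funext fun a => ?_, hC⟩
    have hs := (nodeVar_piecewise h (hZ ω hω ω' hω') a ⟨a, Or.inl (Or.inl a.2), .refl⟩).1 <| by
      by_cases haZ : a.1 ∈ Z
      · exact Or.inr haZ
      · exact Or.inl (mem_reach_self a.2 haZ)
    have he : J.piecewise ω ω' = ω' := funext fun i => by
      by_cases hi : i ∈ J
      · rw [Set.piecewise_eq_of_mem _ _ _ hi, hJ i hi]
      · exact Set.piecewise_eq_of_notMem _ _ _ hi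
    rw [he] at hs
    exact hs.symm
  have hB : Generates Jᶜ (joint (fun a => G.nodeVar Val a) B) C := by
    refine generates_iff.2 ⟨fun ω hω ω' hω' hJ => funext fun b => ?_, fun ω hω ω' hω' => ?_⟩
    · have hs := (nodeVar_piecewise h (hZ ω hω ω' hω') b ⟨b, Or.inl (Or.inr b.2), .refl⟩).2
        fun hb => dSep_iff.1 h b hb b.2
      have he : J.piecewise ω ω' = ω := funext fun i => by
        by_cases hi : i ∈ J
        · exact Set.piecewise_eq_of_mem _ _ _ hi
        · rw [Set.piecewise_eq_of_notMem _ _ _ hi, hJ i hi]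
      rw [he] at hs
      exact hs
    · rw [Set.piecewise_compl]
      exact hC ω' hω' ω hω
  refine Set.eq_empty_of_forall_notMem fun i hi => ?_
  exact hB.history_subset hi.2 (hA.history_subset hi.1)

end

/-! ### The factorization of a distribution along a DAG -/

/-- A node outside an ancestrally closed set `L` is d-separated from `L` given its parents: an
active trail would start along an outgoing edge, could not turn at a collider, since no descendant of the
node is a parent of it, and would thus be a directed path into `L`. -/
theorem dSep_parents {a : V} {L : Set V} (hL : ∀ b ∈ L, ∀ c, G.Adj c b → c ∈ L) (ha : a ∉ L) :
    G.DSep {a} L (G.parents a) := by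
  rintro n w ht h0 hn hact
  have h0 : w 0 = a := h0
  -- the trail is a directed path that starts in `a`
  have hpath : ∀ i ≤ n,
      Relation.ReflTransGen G.Adj a (w i) ∧ (i < n → G.Adj (w i) (w (i + 1))) := by
    intro i
    induction i with
    | zero =>
      intro _
      refine ⟨h0 ▸ .refl, fun hpos => (ht 0 hpos).resolve_right fun hpa => ?_⟩
      refine (hact 1 hpos).2 (fun hcol => ?_) (h0 ▸ hpa)
      exact G.acyclic _ ((Relation.TransGen.single hcol.2.2.1).tail hpa)
    | succ i ih =>
      intro hi
      obtain ⟨hr, hadj⟩ := ih (by lia)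
      have hadj := hadj hi
      refine ⟨hr.tail hadj, fun hi' => (ht (i + 1) hi').resolve_right fun hback => ?_⟩
      obtain ⟨d, hd, hwd⟩ := (hact (i + 1) hi).1 ⟨by lia, hi', hadj, hback⟩
      exact G.acyclic a (Relation.TransGen.tail' ((hr.tail hadj).trans hwd) hd)
  have hup : ∀ b, Relation.ReflTransGen G.Adj a b → b ∈ L → a ∈ L := by
    intro b hb
    induction hb with
    | refl => exact id
    | tail _ hcd ih => exact fun hd => ih (hL _ hd _ hcd)
  exact ha (hup _ (hpath n le_rfl).1 hn)

end DAG

/-! ### Conditional and product distributions -/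

theorem prob_singleton {S : Type*} (P : PMF S) (s : S) : prob P {s} = P s :=
  PMF.toOuterMeasure_apply_singleton P s

theorem prob_univ {S : Type*} (P : PMF S) : prob P Set.univ = 1 :=
  (PMF.toOuterMeasure_apply_eq_one_iff P Set.univ).2 (Set.subset_univ _)

theorem prob_mono {S : Type*} (P : PMF S) {E F : Set S} (h : E ⊆ F) : prob P E ≤ prob P F :=
  MeasureTheory.OuterMeasureClass.measure_mono _ h

theorem prob_le_one {S : Type*} (P : PMF S) (E : Set S) : prob P E ≤ 1 :=
  (prob_mono P (Set.subset_univ E)).trans_eq (prob_univ P)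

/-- A conditional distribution of `X` given the event `E`; it is arbitrary if `E` is a null
event. -/
theorem exists_cond {S A : Type*} (P : PMF S) (X : S → A) (E : Set S) :
    ∃ k : PMF A, ∀ x, prob P {s | X s = x ∧ s ∈ E} = k x * prob P E := by
  by_cases hE : ∃ s ∈ E, s ∈ P.support
  · refine ⟨(P.filter E hE).map X, fun x => ?_⟩
    have h0 : prob P E ≠ 0 := fun h => by
      obtain ⟨s, hs, hs'⟩ := hE
      exact Set.disjoint_left.1 ((PMF.toOuterMeasure_apply_eq_zero_iff P E).1 h) hs' hs
    have ht : prob P E ≠ ⊤ := ((prob_le_one P E).trans_lt ENNReal.one_lt_top).ne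
    have hk : (P.filter E hE).map X x = prob P {s | X s = x ∧ s ∈ E} * (prob P E)⁻¹ := by
      rw [← prob_singleton, prob_map, prob, prob, PMF.toOuterMeasure_apply,
        PMF.toOuterMeasure_apply, ← ENNReal.tsum_mul_right]
      refine tsum_congr fun s => ?_
      have hs : P.filter E hE s = E.indicator P s * (prob P E)⁻¹ := by
        rw [PMF.filter_apply, prob, PMF.toOuterMeasure_apply]
      by_cases h1 : X s = x <;> by_cases h2 : s ∈ E <;> simp [h1, h2, hs]
    rw [hk, mul_assoc, ENNReal.inv_mul_cancel h0 ht, mul_one]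
  · obtain ⟨s₀, -⟩ := P.support_nonempty
    have h0 : prob P E = 0 := (PMF.toOuterMeasure_apply_eq_zero_iff P E).2 <|
      Set.disjoint_left.2 fun s hs hs' => hE ⟨s, hs', hs⟩
    refine ⟨PMF.pure (X s₀), fun x => ?_⟩
    rw [h0, mul_zero]
    exact le_antisymm ((prob_mono P fun s hs => hs.2).trans_eq h0) zero_le

section Product

universe uI uΩ
variable {I : Type uI} [Fintype I] {Ω : I → Type uΩ}

/-- A finite product of distributions on finite sets. -/
theorem exists_pi [∀ i, Finite (Ω i)] (k : ∀ i, PMF (Ω i)) :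
    ∃ Q : PMF (∀ i, Ω i), ∀ s : ∀ i, Set (Ω i),
      prob Q {ω | ∀ i, ω i ∈ s i} = ∏ i, prob (k i) (s i) := by
  have := fun i => Fintype.ofFinite (Ω i)
  have hsum : ∀ s : ∀ i, Set (Ω i),
      ∑ ω : ∀ i, Ω i, {ω : ∀ i, Ω i | ∀ i, ω i ∈ s i}.indicator (fun ω => ∏ i, k i (ω i)) ω =
        ∏ i, prob (k i) (s i) := by
    intro s
    simp only [prob, PMF.toOuterMeasure_apply_fintype]
    rw [Finset.prod_univ_sum, Fintype.piFinset_univ]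
    refine Finset.sum_congr rfl fun ω _ => ?_
    by_cases h : ∀ i, ω i ∈ s i
    · rw [Set.indicator_of_mem (by exact h)]
      exact Finset.prod_congr rfl fun i _ => (Set.indicator_of_mem (h i) _).symm
    · rw [Set.indicator_of_notMem (by exact h)]
      obtain ⟨i, hi⟩ := not_forall.1 h
      exact (Finset.prod_eq_zero (Finset.mem_univ i) (Set.indicator_of_notMem hi _)).symm
  refine ⟨PMF.ofFintype (fun ω => ∏ i, k i (ω i)) ?_, fun s => ?_⟩
  · have h := hsum fun _ => Set.univ
    simpa [prob_univ] using h
  · rw [← hsum s, prob, PMF.toOuterMeasure_apply_fintype]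
    rfl

theorem factorizes_of_prob_pi {Q : PMF (∀ i, Ω i)} {k : ∀ i, PMF (Ω i)}
    (h : ∀ s : ∀ i, Set (Ω i), prob Q {ω | ∀ i, ω i ∈ s i} = ∏ i, prob (k i) (s i)) :
    Factorizes Q := by
  intro ω
  have hω : Q ω = ∏ i, k i (ω i) := by
    have := h fun i => {ω i}
    simp only [Set.mem_singleton_iff, prob_singleton] at this
    rw [← this, ← prob_singleton Q]
    congr 1
    ext ω'
    exact funext_iff
  rw [hω]
  refine Finset.prod_congr rfl fun i _ => ?_
  have hi := h (Function.update (fun _ => Set.univ) i {ω i})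
  rw [Fintype.prod_eq_single i fun j hj => by rw [Function.update_of_ne hj, prob_univ],
    Function.update_self, prob_singleton] at hi
  rw [← hi]
  congr 1
  ext ω'
  rw [Set.mem_ofPred_eq, Set.mem_ofPred_eq]
  constructor
  · intro h'
    have := h' i
    rwa [Function.update_self] at this
  · intro h' j
    rcases eq_or_ne j i with rfl | hj
    · rw [Function.update_self]
      exact h'
    · rw [Function.update_of_ne hj]
      trivial

end Product

theorem joint_eq_iff {V : Type*} {Val : V → Type*} {T : Set V} {x y : ∀ a, Val a} :
    joint (fun a (x : ∀ a, Val a) => x a) T y = joint (fun a x => x a) T x ↔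
      ∀ b ∈ T, y b = x b := by
  simp only [joint, funext_iff, Subtype.forall]

/-! ### The constructed factored space models the distribution -/

namespace DAG

variable {V : Type u} [Finite V] {G : DAG V} {Val : V → Type v}

theorem exists_mem_forall_not_adj (G : DAG V) {L : Set V} (hL : L.Nonempty) :
    ∃ a ∈ L, ∀ b ∈ L, ¬ G.Adj a b := by
  have : Std.Irrefl (flip (Relation.TransGen G.Adj)) := ⟨G.acyclic⟩
  have : IsTrans V (flip (Relation.TransGen G.Adj)) := ⟨fun _ _ _ h h' => h'.trans h⟩
  obtain ⟨a, ha, hmin⟩ :=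
    (Finite.wellFounded_of_trans_of_irrefl (flip (Relation.TransGen G.Adj))).has_min L hL
  exact ⟨a, ha, fun b hb h => hmin b hb (Relation.TransGen.single h)⟩

/-- The observation is `x` if and only if, at every node `a`, the factor selected by the parent
values in `x` has the value `x a`. -/
theorem nodeVar_eq_iff {ω : ∀ i : G.Index Val, Val i.1} {x : ∀ a, Val a} :
    (fun a => G.nodeVar Val a ω) = x ↔ ∀ a, ω ⟨a, fun b => x b⟩ = x a := by
  constructor
  · rintro rfl a
    exact (G.nodeVar_eq Val a ω).symm
  · intro h
    funext a
    induction a using G.wellFounded_adj.induction with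
    | _ a ih =>
      rw [nodeVar_eq, ← h a]
      congr 2
      funext b
      exact ih b.1 b.2

/-- The factorization of `P` along `G`: if every ancestrally closed set is independent of each
further node given the parents of that node, then `P(x)` is the product of the conditional
probabilities `P(x_a | x_pa(a))`. -/
theorem prob_eq_prod {P : PMF (∀ a, Val a)}
    (hP : ∀ (a : V) (L : Set V), (∀ b ∈ L, ∀ c, G.Adj c b → c ∈ L) → a ∉ L →
      CondIndep P (joint (fun a x => x a) {a}) (joint (fun a x => x a) L)
        (joint (fun a x => x a) (G.parents a)))
    {k : ∀ i : G.Index Val, PMF (Val i.1)}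
    (hk : ∀ (i : G.Index Val) (y : Val i.1),
      prob P {x | x i.1 = y ∧ x ∈ {x | joint (fun a x => x a) (G.parents i.1) x = i.2}} =
        k i y * prob P {x | joint (fun a x => x a) (G.parents i.1) x = i.2})
    (x : ∀ a, Val a) (L : Finset V) (hL : ∀ b ∈ L, ∀ c, G.Adj c b → c ∈ L) :
    prob P {y | ∀ b ∈ L, y b = x b} = ∏ a ∈ L, k ⟨a, fun b => x b⟩ (x a) := by
  induction L using Finset.strongInduction with
  | H L ih =>
  rcases L.eq_empty_or_nonempty with rfl | hne
  · simpa using prob_univ P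
  obtain ⟨a, haL, hmax⟩ := G.exists_mem_forall_not_adj (L := (L : Set V)) hne
  have hlow : ∀ b ∈ L.erase a, ∀ c, G.Adj c b → c ∈ L.erase a := fun b hb c hcb =>
    Finset.mem_erase.2 ⟨fun hca => hmax b (Finset.mem_of_mem_erase hb) (hca ▸ hcb),
      hL b (Finset.mem_of_mem_erase hb) c hcb⟩
  have hpa : ∀ b ∈ G.parents a, b ∈ L.erase a := fun b hb =>
    Finset.mem_erase.2 ⟨fun h => hmax a haL (by rw [h] at hb; exact hb), hL a haL b hb⟩
  rw [← Finset.mul_prod_erase L _ haL, ← ih _ (Finset.erase_ssubset haL) hlow]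
  set E : Set (∀ a, Val a) := {y | ∀ b ∈ G.parents a, y b = x b}
  set F : Set (∀ a, Val a) := {y | ∀ b ∈ L.erase a, y b = x b}
  have hFE : F ⊆ E := fun y hy b hb => hy b (hpa b hb)
  have hsplit : {y : ∀ a, Val a | ∀ b ∈ L, y b = x b} = {y | y a = x a ∧ y ∈ F} := by
    ext y
    constructor
    · exact fun h => ⟨h a haL, fun b hb => h b (Finset.mem_of_mem_erase hb)⟩
    · rintro ⟨h, hF⟩ b hb
      rcases eq_or_ne b a with rfl | hba
      · exact h
      · exact hF b (Finset.mem_erase.2 ⟨hba, hb⟩)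
  rw [hsplit]
  have hki : prob P {y | y a = x a ∧ y ∈ E} = k ⟨a, fun b => x b⟩ (x a) * prob P E := by
    have := hk ⟨a, joint (fun a x => x a) (G.parents a) x⟩ (x a)
    simp only [joint_eq_iff] at this
    exact this
  by_cases h0 : prob P E = 0
  · -- a null event for the parents: both sides vanish, whatever the value of `k`
    have hF : prob P F = 0 := le_antisymm ((prob_mono P hFE).trans_eq h0) zero_le
    rw [hF, mul_zero]
    exact le_antisymm ((prob_mono P fun y hy => hy.2).trans_eq hF) zero_le
  have ht : prob P E ≠ ⊤ := ((prob_le_one P E).trans_lt ENNReal.one_lt_top).ne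
  have hci := hP a (L.erase a : Finset V) (by exact_mod_cast hlow) (by simp)
    (joint (fun a x => x a) _ x) (joint (fun a x => x a) _ x) (joint (fun a x => x a) _ x)
  simp only [joint_eq_iff, Set.mem_singleton_iff, forall_eq] at hci
  have hF : {y : ∀ a, Val a | (∀ b ∈ ((L.erase a : Finset V) : Set V), y b = x b) ∧
      ∀ b ∈ G.parents a, y b = x b} = F := by
    ext y
    exact ⟨And.left, fun h => ⟨h, hFE h⟩⟩
  have hF' : {y : ∀ a, Val a | y a = x a ∧ (∀ b ∈ ((L.erase a : Finset V) : Set V), y b = x b) ∧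
      ∀ b ∈ G.parents a, y b = x b} = {y | y a = x a ∧ y ∈ F} := by
    ext y
    exact and_congr_right fun _ => Set.ext_iff.1 hF y
  rw [hF, hF'] at hci
  have hci : prob P {y | y a = x a ∧ y ∈ E} * prob P F =
    prob P {y | y a = x a ∧ y ∈ F} * prob P E := hci
  rw [hki] at hci
  refine (ENNReal.mul_left_inj h0 ht).1 ?_
  rw [← hci]
  ring

/-- The constructed factored space models `P`: give the factor `(a, x_pa(a))` the conditional
distribution of `X_a` given `X_pa(a) = x_pa(a)`. -/
theorem isModelOf_toFSM [∀ a, Finite (Val a)] {P : PMF (∀ a, Val a)}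
    (hP : ∀ (a : V) (L : Set V), (∀ b ∈ L, ∀ c, G.Adj c b → c ∈ L) → a ∉ L →
      CondIndep P (joint (fun a x => x a) {a}) (joint (fun a x => x a) L)
        (joint (fun a x => x a) (G.parents a))) :
    (G.toFSM Val).IsModelOf P := by
  have := Fintype.ofFinite V
  let : Fintype (G.Index Val) := Fintype.ofFinite _
  choose k hk using fun i : G.Index Val => exists_cond P (fun x => x i.1)
    {x | joint (fun a x => x a) (G.parents i.1) x = i.2}
  obtain ⟨Q, hQ⟩ := exists_pi k
  have hfac : Factorizes Q := factorizes_of_prob_pi hQ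
  refine ⟨Q, hfac, fun x => ?_⟩
  have hPx : P x = ∏ a, k ⟨a, fun b => x b⟩ (x a) := by
    rw [← prob_eq_prod hP hk x Finset.univ fun _ _ c _ => Finset.mem_univ c, ← prob_singleton]
    congr 1
    ext y
    simp [funext_iff]
  -- only the factors that are selected by the values in `x` are constrained by the event `O = x`
  set s : ∀ i : G.Index Val, Set (Val i.1) := fun i =>
    {y | i.2 = (fun b : G.parents i.1 => x b) → y = x i.1}
  have hO : {ω | (G.toFSM Val).O ω = x} = {ω : ∀ i : G.Index Val, Val i.1 | ∀ i, ω i ∈ s i} := by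
    ext ω
    refine nodeVar_eq_iff.trans ⟨?_, fun h a => h ⟨a, fun b => x b⟩ rfl⟩
    rintro h ⟨a, y⟩ hy
    change y = (fun b : G.parents a => x b) at hy
    subst hy
    exact h a
  rw [hPx]
  refine (congrArg (prob Q) hO).trans ((hQ s).trans (Eq.symm ?_))
  refine Fintype.prod_of_injective (fun a => (⟨a, fun b => x b⟩ : G.Index Val))
    (fun a b h => congrArg Sigma.fst h) _ _ ?_ fun a => ?_
  · rintro ⟨a, y⟩ hi
    have hsi : s ⟨a, y⟩ = Set.univ := Set.eq_univ_of_forall fun z (hy : y = _) =>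
      absurd ⟨a, by rw [hy]⟩ hi
    rw [hsi, prob_univ]
  · have hsi : s ⟨a, fun b => x b⟩ = {x a} := Set.ext fun z => ⟨fun h => h rfl, fun h _ => h⟩
    rw [hsi, prob_singleton]

theorem IsPerfectMap.toFSM [∀ a, Finite (Val a)] {P : PMF (∀ a, Val a)} (h : G.IsPerfectMap P) :
    (G.toFSM Val).IsPerfectMap P (fun a x => x a) := by
  have hmodel : (G.toFSM Val).IsModelOf P := isModelOf_toFSM fun a L hL ha =>
    (h {a} L (G.parents a)).1 (dSep_parents hL ha)
  obtain ⟨x₀, -⟩ := P.support_nonempty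
  have : ∀ a, Nonempty (Val a) := fun a => ⟨x₀ a⟩
  exact ⟨hmodel, fun W₁ W₂ W₃ => ⟨fun hci => ((h W₁ W₂ W₃).2 hci).structIndep,
    fun hsi => hmodel.condIndep hsi⟩⟩

end DAG

/-! ### A node that is a function of the other node -/

section Deterministic

theorem prob_ne_zero {S : Type*} {P : PMF S} {E : Set S} {s : S} (hs : P s ≠ 0) (h : s ∈ E) :
    prob P E ≠ 0 := fun h0 =>
  Set.disjoint_left.1 ((PMF.toOuterMeasure_apply_eq_zero_iff P E).1 h0)
    ((PMF.mem_support_iff P s).2 hs) h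

theorem exists_of_prob_ne_zero {S : Type*} {P : PMF S} {E : Set S} (h : prob P E ≠ 0) :
    ∃ s ∈ E, P s ≠ 0 := by
  by_contra! hE
  exact h <| (PMF.toOuterMeasure_apply_eq_zero_iff P E).2 <| Set.disjoint_left.2 fun s hs hs' =>
    (PMF.mem_support_iff P s).1 hs (hE s hs')

/-- If `X` determines `Y` almost surely, independence given `Z` makes `Y` constant given `Z`: any two
values of `X` and `Y` that are possible given `Z = z` occur together. -/
theorem CondIndep.eq_of_determines {S A B D : Type*} {P : PMF S} {X : S → A} {Y : S → B}
    {Z : S → D} (h : CondIndep P X Y Z)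
    (hXY : ∀ s t, P s ≠ 0 → P t ≠ 0 → X s = X t → Y s = Y t)
    {s t : S} (hs : P s ≠ 0) (ht : P t ≠ 0) (hZ : Z s = Z t) : Y s = Y t := by
  have h1 : prob P {r | X r = X s ∧ Z r = Z s} ≠ 0 := prob_ne_zero hs ⟨rfl, rfl⟩
  have h2 : prob P {r | Y r = Y t ∧ Z r = Z s} ≠ 0 := prob_ne_zero ht ⟨rfl, hZ.symm⟩
  have h3 := mul_ne_zero h1 h2
  rw [h] at h3
  obtain ⟨r, hr, hr0⟩ := exists_of_prob_ne_zero (left_ne_zero_of_mul h3)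
  exact (hXY s r hs hr0 hr.1.symm).trans hr.2.1

theorem CondIndep.symm {S A B D : Type*} {P : PMF S} {X : S → A} {Y : S → B} {Z : S → D}
    (h : CondIndep P X Y Z) : CondIndep P Y X Z := by
  intro y x z
  rw [mul_comm, h x y z]
  simp only [and_left_comm]

theorem history_eq_empty {I : Type*} {Ω : I → Type*} {A : Type*} [Nonempty A]
    {X : (∀ i, Ω i) → A} {C : Set (∀ i, Ω i)} (h : ∀ ω ∈ C, ∀ ω' ∈ C, X ω = X ω') :
    history X C = ∅ := by
  have hgen : Generates ∅ X C := by
    refine generates_iff.2 ⟨fun ω hω ω' hω' _ => h ω hω ω' hω', fun ω _ ω' hω' => ?_⟩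
    rwa [Set.piecewise_empty]
  exact Set.subset_empty_iff.1 hgen.history_subset

/-- The factored space with a single factor, the support of `P`. -/
def supportFSM {Obs : Type w} [Finite Obs] (P : PMF Obs) : FSM.{0, w, w} Obs where
  I := Unit
  fintypeI := inferInstance
  Ω := fun _ => P.support
  finiteΩ := fun _ => inferInstance
  O := fun ω => ω ()

theorem isModelOf_supportFSM {Obs : Type w} [Finite Obs] (P : PMF Obs) :
    (supportFSM P).IsModelOf P := by
  have : Nonempty P.support := P.support_nonempty.to_subtype
  let g : Obs → Unit → P.support := fun o _ =>
    if h : o ∈ P.support then ⟨o, h⟩ else Classical.arbitrary _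
  have hfac : Factorizes (P.map g) := by
    intro ω
    rw [Fintype.prod_unique, ← prob_singleton]
    congr 1
    ext ω'
    exact funext_iff.trans Unique.forall_iff
  refine ⟨P.map g, hfac, fun o => ?_⟩
  change prob (P.map g) {ω : Unit → P.support | (ω ()).1 = o} = P o
  rw [prob_map, ← prob_singleton P]
  refine PMF.toOuterMeasure_apply_eq_of_inter_support_eq P (Set.ext fun o' => ?_)
  refine and_congr_left fun ho' => ?_
  have hg : (g o' ()).1 = o' := congrArg Subtype.val (dif_pos ho')
  rw [Set.mem_preimage, Set.mem_ofPred_eq, hg, Set.mem_singleton_iff]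

theorem history_supportFSM_eq_empty {Obs : Type w} [Finite Obs] {P : PMF Obs} {A D : Type*}
    [Nonempty A] {X : Obs → A} {Z : Obs → D}
    (h : ∀ s t, P s ≠ 0 → P t ≠ 0 → Z s = Z t → X s = X t) (z : D) :
    history (X ∘ (supportFSM P).O) {ω | (Z ∘ (supportFSM P).O) ω = z} = ∅ :=
  history_eq_empty fun ω hω ω' hω' =>
    h (ω ()).1 (ω' ()).1 (ω ()).2 (ω' ()).2 (Eq.trans hω (Eq.symm hω'))

/-- The support of `P` as a single factor is a perfect map if the variable `1` is almost surely a
function of the variable `0`. For any two joint variables `X`, `Y`, one determines the other, so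
independence given `Z` means that `Z` determines `X` or `Y`; then one of the histories is empty. -/
theorem supportFSM_isPerfectMap {Val : Fin 2 → Type w} [∀ a, Finite (Val a)]
    {P : PMF (∀ a, Val a)} {f : Val 0 → Val 1} (hf : ∀ x, P x ≠ 0 → x 1 = f (x 0)) :
    (supportFSM P).IsPerfectMap P (fun a x => x a) := by
  refine ⟨isModelOf_supportFSM P, fun W₁ W₂ W₃ =>
    ⟨fun hci z => ?_, fun h => (isModelOf_supportFSM P).condIndep h⟩⟩
  have hne : ∀ a, Nonempty (Val a) := by
    obtain ⟨x₀, -⟩ := P.support_nonempty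
    exact fun a => ⟨x₀ a⟩
  -- of two sets of nodes, one determines the other almost surely
  have hdet : ∀ T T' : Set (Fin 2), 0 ∈ T ∨ 0 ∉ T' ∧ (1 ∈ T ∨ 1 ∉ T') →
      ∀ s t : ∀ a, Val a, P s ≠ 0 → P t ≠ 0 →
        joint (fun a x => x a) T s = joint (fun a x => x a) T t →
        joint (fun a x => x a) T' s = joint (fun a x => x a) T' t := by
    intro T T' h s t hs ht hst
    have hst' : ∀ a ∈ T, s a = t a := fun a ha => congrFun hst ⟨a, ha⟩
    have hall : ∀ a ∈ T', s a = t a := by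
      rw [Fin.forall_fin_two]
      rcases h with h | ⟨h0, h1⟩
      · have h0 := hst' 0 h
        exact ⟨fun _ => h0, fun _ => by rw [hf s hs, hf t ht, h0]⟩
      · exact ⟨fun h => absurd h h0, fun h => hst' 1 (h1.resolve_right (not_not.2 h))⟩
    exact funext fun a => hall a a.2
  have hcases : (0 ∈ W₁ ∨ 0 ∉ W₂ ∧ (1 ∈ W₁ ∨ 1 ∉ W₂)) ∨
      (0 ∈ W₂ ∨ 0 ∉ W₁ ∧ (1 ∈ W₂ ∨ 1 ∉ W₁)) := by tauto
  rcases hcases with h | h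
  · have hY := history_supportFSM_eq_empty
      (fun s t hs ht hZ => hci.eq_of_determines (hdet W₁ W₂ h) hs ht hZ) z
    exact (congrArg _ hY).trans (Set.inter_empty _)
  · have hX := history_supportFSM_eq_empty
      (fun s t hs ht hZ => hci.symm.eq_of_determines (hdet W₂ W₁ h) hs ht hZ) z
    exact (congrArg (· ∩ _) hX).trans (Set.empty_inter _)

/-- A DAG never represents a determinism `X₁ = f(X₀)`: the node `1` is independent of itself given
the node `0`, but is not d-separated from itself. -/
theorem not_isPerfectMap_of_determines {Val : Fin 2 → Type w} [∀ a, Finite (Val a)]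
    {P : PMF (∀ a, Val a)} {f : Val 0 → Val 1} (hf : ∀ x, P x ≠ 0 → x 1 = f (x 0))
    (G : DAG (Fin 2)) : ¬ G.IsPerfectMap P := by
  intro h
  refine DAG.dSep_iff.1 ((h {1} {1} {0}).2 ?_) 1 (DAG.mem_reach_self rfl (by decide)) rfl
  have hne : ∀ a, Nonempty (Val a) := by
    obtain ⟨x₀, -⟩ := P.support_nonempty
    exact fun a => ⟨x₀ a⟩
  -- in the single-factor model on the support of `P`, the history of `X₁` given `X₀` is empty
  refine (isModelOf_supportFSM P).condIndep fun z => ?_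
  rw [history_supportFSM_eq_empty, Set.inter_empty]
  intro s t hs ht hst
  have h0 : s 0 = t 0 := congrFun hst ⟨0, rfl⟩
  funext ⟨a, ha⟩
  obtain rfl : a = 1 := ha
  change s 1 = t 1
  rw [hf s hs, hf t ht, h0]

theorem exists_pmf_surjective_not_injective :
    ∃ (Val : Fin 2 → Type) (_ : ∀ a, Finite (Val a)) (_ : ∀ a, Nontrivial (Val a))
      (P : PMF (∀ a, Val a)) (f : Val 0 → Val 1),
      Function.Surjective f ∧ ¬ Function.Injective f ∧ ∀ x, P x ≠ 0 ↔ x 1 = f (x 0) := by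
  -- the uniform distribution on the graph of a surjection from three points onto two points
  let Val : Fin 2 → Type := fun a => Fin (3 - a)
  let f : Fin 3 → Fin 2 := ![0, 1, 1]
  let g : Fin 3 → ∀ a, Val a := fun i => Fin.cons (α := Val) i (Fin.cons (f i) finZeroElim)
  refine ⟨Val, fun _ => inferInstanceAs (Finite (Fin _)), Fin.forall_fin_two.2
    ⟨inferInstanceAs (Nontrivial (Fin 3)), inferInstanceAs (Nontrivial (Fin 2))⟩,
    (PMF.uniformOfFintype (Fin 3)).map g, f, by decide, by decide, fun x => ?_⟩
  rw [← PMF.mem_support_iff, PMF.support_map, PMF.support_uniformOfFintype]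
  constructor
  · rintro ⟨i, -, rfl⟩
    rfl
  · intro hx
    refine ⟨x 0, trivial, funext <| Fin.forall_fin_two.2 ⟨rfl, hx.symm⟩⟩

end Deterministic

end FactoredSpaces

theorem mainTheorem7 :
    -- a perfect-map DAG gives a perfect-map factored space model, by the construction
    (∀ (V : Type u) [Finite V] (Val : V → Type v) [∀ a, Finite (Val a)]
      (P : PMF (∀ a, Val a)) (G : FactoredSpaces.DAG V),
      G.IsPerfectMap P → (G.toFSM Val).IsPerfectMap P (fun a x => x a)) ∧
    -- two nodes, the second one a deterministic function of the first one: there is a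
    -- perfect-map factored space model, but no perfect-map DAG
    (∀ (Val : Fin 2 → Type w) [∀ a, Finite (Val a)] (P : PMF (∀ a, Val a))
      (f : Val 0 → Val 1), (∀ x, P x ≠ 0 → x 1 = f (x 0)) →
      (∃ F : FactoredSpaces.FSM.{0, w, w} (∀ a, Val a), F.IsPerfectMap P (fun a x => x a)) ∧
      ∀ G : FactoredSpaces.DAG (Fin 2), ¬ G.IsPerfectMap P) ∧
    -- such distributions exist, with nontrivial value spaces all of whose values occur and
    -- with a function that is surjective and not injective
    (∃ (Val : Fin 2 → Type) (_ : ∀ a, Finite (Val a)) (_ : ∀ a, Nontrivial (Val a))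
      (P : PMF (∀ a, Val a)) (f : Val 0 → Val 1),
      Function.Surjective f ∧ ¬ Function.Injective f ∧ (∀ x, P x ≠ 0 ↔ x 1 = f (x 0)) ∧
      (∃ F : FactoredSpaces.FSM.{0, 0, 0} (∀ a, Val a), F.IsPerfectMap P (fun a x => x a)) ∧
      ∀ G : FactoredSpaces.DAG (Fin 2), ¬ G.IsPerfectMap P) := by
  refine ⟨fun V _ Val _ P G h => h.toFSM, fun Val _ P f hf =>
    ⟨⟨_, FactoredSpaces.supportFSM_isPerfectMap hf⟩,
      FactoredSpaces.not_isPerfectMap_of_determines hf⟩, ?_⟩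
  obtain ⟨Val, hfin, hnt, P, f, hsurj, hinj, hP⟩ :=
    FactoredSpaces.exists_pmf_surjective_not_injective
  have hf : ∀ x, P x ≠ 0 → x 1 = f (x 0) := fun x => (hP x).1
  exact ⟨Val, hfin, hnt, P, f, hsurj, hinj, hP, ⟨_, FactoredSpaces.supportFSM_isPerfectMap hf⟩,
    FactoredSpaces.not_isPerfectMap_of_determines hf⟩
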